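/- Let $d$ be a natural number that is not a perfect square. For a real irrational $x$, its complete quotients are $x_0=x$, $x_{n+1}=1/(x_n-\lfloor x_n\rfloor)$, and its partial quotients are $\lfloor x_n\rfloor$; the smallest period of the continued fraction expansion of $x$ is the least $T\ge 1$ such that $\lfloor x_{n+T}\rfloor=\lfloor x_n\rfloor$ for all sufficiently large $n$ (such a $T$ exists for $x=\sqrt d$). Let $(u_n)_{n\ge0}$ and $(v_n)_{n\ge0}$ be the sequences of positive integers such that, for every $n$, the complete quotient of index $n$ of $\lfloor\sqrt d\rfloor+\sqrt d$ equals $\dfrac{u_n+\sqrt d}{v_n}$; equivalently $u_0=\lfloor\sqrt d\rfloor$, $v_0=1$, $u_{n+1}=a'_nv_n-u_n$ and $v_{n+1}=(d-u_{n+1}^2)/v_n$, where $a'_n$ is the partial quotient of index $n$ of $\lfloor\sqrt d\rfloor+\sqrt d$. **Theorem.** Let $a$ and $b$ be coprime integers with $2\le a<b$ such that $d:=ab$ is not a perfect square. Let $(u_n)$ and $(v_n)$ be the sequences attached to $\sqrt d$ as above, and let $T$ be the smallest period of the continued fraction expansion of $\sqrt d$. Suppose that $T\equiv 0\pmod 4$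 and that $a$ is odd, and put $N=T/2$. Then the equation $ax^2-by^2=1$ has a solution $(x,y)\in\mathbb N^2$ if and only if $v_N=a$. Moreover $v_N$ divides $2u_N$; in particular, if $v_N=a$, then $v_N$ divides $u_N$. -/

import Mathlib

/-- The complete quotients of a real number `x` in its regular continued fraction expansion:
`x_0 = x` and `x_{n+1} = 1 / (x_n - ⌊x_n⌋)`. Used only for irrational `x`, where the process
never stops (no denominator vanishes). -/
noncomputable def completeQuotient (x : ℝ) : ℕ → ℝ
  | 0 => x
  | n + 1 => 1 / (completeQuotient x n - ⌊completeQuotient x n⌋)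

/-- The partial quotients `a_n = ⌊x_n⌋` of a real number `x`, that is `x = [a_0, a_1, a_2, …]`. -/
noncomputable def partialQuotient (x : ℝ) (n : ℕ) : ℤ :=
  ⌊completeQuotient x n⌋

/-- `T` is a period of the continued fraction expansion of `x`: the sequence of partial quotients
is periodic of period `T ≥ 1` from some rank on. -/
def IsCFPeriod (x : ℝ) (T : ℕ) : Prop :=
  0 < T ∧ ∃ n₀ : ℕ, ∀ n : ℕ, n₀ ≤ n → partialQuotient x (n + T) = partialQuotient x n

/-- The smallest period of the continued fraction expansion of `x`. It is a genuine period when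
`x` is the square root of a natural number that is not a perfect square, see
`isLeast_minCFPeriod`. -/
noncomputable def minCFPeriod (x : ℝ) : ℕ :=
  sInf {T : ℕ | IsCFPeriod x T}

/-- The pairs `(u_n, v_n)` attached to `√d`, given by `u_0 = ⌊√d⌋`, `v_0 = 1`,
`u_{n+1} = a'_n v_n - u_n` and `v_{n+1} = (d - u_{n+1}^2) / v_n`, where `a'_n` is the partial
quotient of index `n` of `⌊√d⌋ + √d`. If `d` is not a perfect square, the division is exact and
`(u_n + √d) / v_n` is the complete quotient of index `n` of `⌊√d⌋ + √d`, see `uvSeq_spec`. -/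
noncomputable def uvSeq (d : ℕ) : ℕ → ℤ × ℤ
  | 0 => (⌊√(d : ℝ)⌋, 1)
  | n + 1 =>
    let u' : ℤ :=
      partialQuotient (⌊√(d : ℝ)⌋ + √(d : ℝ)) n * (uvSeq d n).2 - (uvSeq d n).1
    (u', ((d : ℤ) - u' ^ 2) / (uvSeq d n).2)

/-- The sequence `(u_n)` attached to `√d`. -/
noncomputable def uSeq (d n : ℕ) : ℤ := (uvSeq d n).1

/-- The sequence `(v_n)` attached to `√d`. -/
noncomputable def vSeq (d n : ℕ) : ℤ := (uvSeq d n).2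

/-- The partial quotients of an irrational number are those of Mathlib's continued fraction. -/
theorem partDens_eq_partialQuotient {x : ℝ} (hx : Irrational x) :
    (GenContFract.of x).h = partialQuotient x 0 ∧
      ∀ n : ℕ, (GenContFract.of x).partDens.get? n = some (partialQuotient x (n + 1) : ℝ) := by
  have hirr : ∀ n, Irrational (completeQuotient x n) := by
    intro n
    induction n with
    | zero => exact hx
    | succ n ih => rw [completeQuotient, one_div, irrational_inv_iff]; exact ih.sub_intCast _
  have hst : ∀ n, GenContFract.IntFractPair.stream x n
      = some (GenContFract.IntFractPair.of (completeQuotient x n)) := by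
    intro n
    induction n with
    | zero => rfl
    | succ n ih =>
      have h0 : (GenContFract.IntFractPair.of (completeQuotient x n)).fr ≠ 0 :=
        ((hirr n).sub_intCast _).ne_zero
      rw [GenContFract.IntFractPair.stream_succ_of_some ih h0]
      rw [completeQuotient, one_div]
      rfl
  refine ⟨by simp [partialQuotient, completeQuotient], fun n => ?_⟩
  have h := GenContFract.get?_of_eq_some_of_succ_get?_intFractPair_stream (hst (n + 1))
  rw [GenContFract.partDen_eq_s_b h]
  rfl

/-- The sequences `(u_n)`, `(v_n)` consist of positive integers, `u_n ≤ ⌊√d⌋`, `v_n` divides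
`d - u_n^2`, and `(u_n + √d) / v_n` is the complete quotient of index `n` of `⌊√d⌋ + √d`. -/
theorem uvSeq_spec {d : ℕ} (hd : ¬ IsSquare d) (n : ℕ) :
    0 < uSeq d n ∧ 0 < vSeq d n ∧ uSeq d n ≤ ⌊√(d : ℝ)⌋ ∧ vSeq d n ∣ (d : ℤ) - uSeq d n ^ 2 ∧
      completeQuotient (⌊√(d : ℝ)⌋ + √(d : ℝ)) n = (uSeq d n + √(d : ℝ)) / vSeq d n ∧
      1 < completeQuotient (⌊√(d : ℝ)⌋ + √(d : ℝ)) n := by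
  have hirr : Irrational √(d : ℝ) := irrational_sqrt_natCast_iff.mpr hd
  have hsq : √(d : ℝ) ^ 2 = d := Real.sq_sqrt (Nat.cast_nonneg d)
  have hd0 : d ≠ 0 := fun h => hd (h ▸ IsSquare.zero)
  have h1 : (1 : ℝ) ≤ √(d : ℝ) := by
    rw [Real.one_le_sqrt]; exact_mod_cast Nat.one_le_iff_ne_zero.mpr hd0
  have hfl : (⌊√(d : ℝ)⌋ : ℝ) ≤ √(d : ℝ) := Int.floor_le _
  have ha0 : (1 : ℤ) ≤ ⌊√(d : ℝ)⌋ := Int.le_floor.mpr (by simpa using h1)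
  have ha0' : (1 : ℝ) ≤ (⌊√(d : ℝ)⌋ : ℝ) := by exact_mod_cast ha0
  set s : ℝ := √(d : ℝ) with hs
  induction n with
  | zero =>
    refine ⟨?_, ?_, ?_, ?_, ?_, ?_⟩ <;> simp only [uSeq, vSeq, uvSeq, completeQuotient, ← hs]
    · omega
    · norm_num
    · exact le_rfl
    · exact one_dvd _
    · simp
    · linarith
  | succ n ih =>
    obtain ⟨hu, hv, hua, hdvd, hx, hx1⟩ := ih
    set x : ℝ := completeQuotient (⌊s⌋ + s) n with hxdef
    have hvR : (0 : ℝ) < (vSeq d n : ℝ) := by exact_mod_cast hv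
    have huR : (0 : ℝ) < (uSeq d n : ℝ) := by exact_mod_cast hu
    have huaR : (uSeq d n : ℝ) ≤ s := le_trans (by exact_mod_cast hua) hfl
    have hu' : uSeq d (n + 1) = ⌊x⌋ * vSeq d n - uSeq d n := rfl
    have hv' : vSeq d (n + 1) = ((d : ℤ) - uSeq d (n + 1) ^ 2) / vSeq d n := rfl
    have hxv : x * vSeq d n = uSeq d n + s := by rw [hx]; field_simp
    have hf1 : (1 : ℝ) ≤ (⌊x⌋ : ℝ) := by exact_mod_cast Int.le_floor.mpr (by simpa using hx1.le)
    have hfx : (⌊x⌋ : ℝ) ≤ x := Int.floor_le x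
    have hxf : x < ⌊x⌋ + 1 := Int.lt_floor_add_one x
    have hu'R : (uSeq d (n + 1) : ℝ) = ⌊x⌋ * vSeq d n - uSeq d n := by
      rw [hu']; push_cast; ring
    have hupos : (0 : ℝ) < (uSeq d (n + 1) : ℝ) := by nlinarith
    have hule : (uSeq d (n + 1) : ℝ) ≤ s := by nlinarith
    have hult : (uSeq d (n + 1) : ℝ) < s := lt_of_le_of_ne hule (hirr.ne_int _).symm
    have hdvd' : vSeq d n ∣ (d : ℤ) - uSeq d (n + 1) ^ 2 := by
      have : (d : ℤ) - uSeq d (n + 1) ^ 2 = ((d : ℤ) - uSeq d n ^ 2)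
          - vSeq d n * (⌊x⌋ * (⌊x⌋ * vSeq d n - 2 * uSeq d n)) := by rw [hu']; ring
      rw [this]
      exact dvd_sub hdvd (dvd_mul_right _ _)
    have hmul : vSeq d (n + 1) * vSeq d n = (d : ℤ) - uSeq d (n + 1) ^ 2 := by
      rw [hv']; exact Int.ediv_mul_cancel hdvd'
    have hmulR : (vSeq d (n + 1) : ℝ) * vSeq d n
        = (s - uSeq d (n + 1)) * (uSeq d (n + 1) + s) := by
      have : ((vSeq d (n + 1) * vSeq d n : ℤ) : ℝ) = ((d : ℤ) - uSeq d (n + 1) ^ 2 : ℤ) := by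
        rw [hmul]
      push_cast at this
      rw [this, ← hsq]; ring
    have hvpos : (0 : ℝ) < (vSeq d (n + 1) : ℝ) := by
      have : 0 < (vSeq d (n + 1) : ℝ) * vSeq d n := by
        rw [hmulR]; exact mul_pos (by linarith) (by linarith)
      exact pos_of_mul_pos_left this hvR.le
    have hfr : (x - ⌊x⌋) * vSeq d n = s - uSeq d (n + 1) := by rw [hu'R]; linarith
    have hfr0 : 0 < x - ⌊x⌋ :=
      pos_of_mul_pos_left (by rw [hfr]; linarith) hvR.le
    have hcq : completeQuotient (⌊s⌋ + s) (n + 1) = 1 / (x - ⌊x⌋) := by rw [completeQuotient]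
    refine ⟨by exact_mod_cast hupos, by exact_mod_cast hvpos, Int.le_floor.mpr hule,
      ⟨vSeq d n, hmul.symm⟩, ?_, ?_⟩
    · rw [hcq, div_eq_div_iff hfr0.ne' hvpos.ne', one_mul]
      have : (vSeq d (n + 1) : ℝ) * vSeq d n
          = ((uSeq d (n + 1) + s) * (x - ⌊x⌋)) * vSeq d n := by
        rw [hmulR, ← hfr]; ring
      exact mul_right_cancel₀ hvR.ne' this
    · rw [hcq, lt_div_iff₀ hfr0]; linarith

/-- The smallest period of `√d` is indeed a period, if `d` is not a perfect square. -/
theorem isLeast_minCFPeriod {d : ℕ} (hd : ¬ IsSquare d) :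
    IsLeast {T : ℕ | IsCFPeriod √(d : ℝ) T} (minCFPeriod √(d : ℝ)) := by
  set y : ℝ := ⌊√(d : ℝ)⌋ + √(d : ℝ) with hy
  -- the pairs `(u_n, v_n)` stay in a finite set, so some complete quotient of `y` recurs
  have hfin : ∀ n, uvSeq d n ∈ Set.Icc (0 : ℤ) d ×ˢ Set.Icc (0 : ℤ) d := by
    intro n
    obtain ⟨hu, hv, -, hdvd, -, -⟩ := uvSeq_spec hd n
    obtain ⟨hu', hv', hua', -, -, -⟩ := uvSeq_spec hd (n + 1)
    obtain ⟨-, -, hua, -, -, -⟩ := uvSeq_spec hd n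
    have hs : (uSeq d n : ℝ) ≤ √(d : ℝ) := Int.le_floor.mp hua
    have hsq : √(d : ℝ) ^ 2 = d := Real.sq_sqrt (Nat.cast_nonneg d)
    have huR : (0 : ℝ) < uSeq d n := by exact_mod_cast hu
    have hud : uSeq d n ^ 2 ≤ (d : ℤ) := by
      have : (uSeq d n : ℝ) ^ 2 ≤ d := by rw [← hsq]; exact pow_le_pow_left₀ huR.le hs 2
      exact_mod_cast this
    have hne : (d : ℤ) - uSeq d n ^ 2 ≠ 0 := by
      intro h
      refine hd ⟨(uSeq d n).natAbs, ?_⟩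
      zify
      rw [abs_mul_abs_self]; nlinarith
    have hvd := Int.le_of_dvd (lt_of_le_of_ne (by linarith) hne.symm) hdvd
    exact ⟨⟨hu.le, by show uSeq d n ≤ _; nlinarith⟩,
      ⟨hv.le, by show vSeq d n ≤ _; nlinarith⟩⟩
  obtain ⟨i, j, hij, he⟩ : ∃ i j : ℕ, i < j ∧ uvSeq d i = uvSeq d j := by
    obtain ⟨i, -, j, -, hij, he⟩ := Set.infinite_univ.exists_lt_map_eq_of_mapsTo
      (f := uvSeq d) (fun n _ => hfin n) ((Set.finite_Icc _ _).prod (Set.finite_Icc _ _))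
    exact ⟨i, j, hij, he⟩
  have hcq : ∀ k, completeQuotient y (i + k) = completeQuotient y (j + k) := by
    intro k
    induction k with
    | zero =>
      have h1 := (uvSeq_spec hd i).2.2.2.2.1
      have h2 := (uvSeq_spec hd j).2.2.2.2.1
      simp only [uSeq, vSeq, he] at h1 h2
      exact h1.trans h2.symm
    | succ k ih => rw [← add_assoc, ← add_assoc, completeQuotient, completeQuotient, ih]
  have hshift : ∀ n, completeQuotient √(d : ℝ) (n + 1) = completeQuotient y (n + 1) := by
    intro n
    induction n with
    | zero => simp only [completeQuotient, hy, Int.floor_intCast_add]; push_cast; ring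
    | succ n ih => rw [completeQuotient, ih, ← completeQuotient]
  have hne : {T : ℕ | IsCFPeriod √(d : ℝ) T}.Nonempty := by
    refine ⟨j - i, by omega, i + 1, fun n hn => ?_⟩
    obtain ⟨k, rfl⟩ : ∃ k, n = i + k + 1 := ⟨n - i - 1, by omega⟩
    have e : i + k + 1 + (j - i) = j + k + 1 := by omega
    rw [partialQuotient, partialQuotient, e, hshift, hshift, add_assoc, add_assoc, hcq]
  exact ⟨Nat.sInf_mem hne, fun _ h => Nat.sInf_le h⟩

/-!
The pairs `(u_n, v_n)` obey `v_n v_{n+1} = d - u_{n+1}²` and `v_n ∣ u_n + u_{n+1}`, and both `u_n`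
and `u_{n+1}` lie in the window `(⌊√d⌋ - v_n, ⌊√d⌋]`, so each of them is determined by the other one
and `v_n`. This description is invariant under reversal of the sequence, whence the reflection
principle `uvSeq_reflect`: an index `m` with `v_m ∣ 2 u_m`, that is `u_{m+1} = u_m`, is a centre of
symmetry. The index `0` is one, since `u_1 = u_0`.

As `v_T = 1`, reflection gives `u_{N+1} = u_N` for `N = T / 2`, so `v_N ∣ 2 u_N`
(`vSeq_dvd_two_mul_uSeq`); if `v_N = a` is odd, then `a ∣ u_N`.

Write `p / q` for the convergent of index `m - 1` of `√d`. Then `p² - d q² = (-1)^m v_m` and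
`p = u_m q + v_m q'`, where `q'` is the preceding denominator (`contNum_sq_sub`, `cont_sqrt_spec`).
If `v_N = a`, then `a ∣ p` for `m = N`, and since `N` is even, dividing the norm equation by `a`
gives a solution.

Conversely, a solution gives `(a x)² - d y² = a` with `0 < a < √d`. By Legendre's criterion
`a x / y` is a convergent (`exists_eq_cont_of_sq_sub`), so that `v_m = a` for some `m`, and the
linear relation gives `a ∣ u_m` (`exists_vSeq_eq_of_sol`). Thus `m` is a centre of symmetry, and
composing the reflections about `0` and `m` shows that `2 m` is a period
(`vSeq_add_self_eq_one`), hence a multiple of `T` (`minCFPeriod_sqrt_dvd`). So `m` is a multiple of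
`N`; an even multiple would give `v_m = 1`, and an odd one gives `v_N = v_m = a`.

The period `T` is defined through the partial quotients; it becomes a period of `(u_n, v_n)`
because an irrational number is determined by its partial quotients (`eq_of_partialQuotient_eq`)
and because the recursion can be run backwards (`uvSeq_congr_of_succ`).
-/

/-! ### Continuants -/

/-- Numerators of the convergents of `[c 0, c 1, …]`, with the index shifted by one:
`contNum c (n + 1) / contDen c (n + 1)` is the `n`-th convergent, and `contNum c 0 = 1`. -/
def contNum (c : ℕ → ℤ) : ℕ → ℤ
  | 0 => 1
  | 1 => c 0
  | n + 2 => c (n + 1) * contNum c (n + 1) + contNum c n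

/-- Denominators of the convergents of `[c 0, c 1, …]`, with the same shift of index as `contNum`;
in particular `contDen c 0 = 0`. -/
def contDen (c : ℕ → ℤ) : ℕ → ℤ
  | 0 => 0
  | 1 => 1
  | n + 2 => c (n + 1) * contDen c (n + 1) + contDen c n

theorem contNum_det (c : ℕ → ℤ) (n : ℕ) :
    contNum c (n + 1) * contDen c n - contNum c n * contDen c (n + 1) = (-1) ^ (n + 1) := by
  induction n with
  | zero => simp [contNum, contDen]
  | succ n ih =>
    rw [contNum, contDen, pow_succ]
    linear_combination -ih

theorem contDen_pos {c : ℕ → ℤ} (hc : ∀ n, 1 ≤ c (n + 1)) (n : ℕ) :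
    0 ≤ contDen c n ∧ 1 ≤ contDen c (n + 1) := by
  induction n with
  | zero => simp [contDen]
  | succ n ih =>
    refine ⟨by linarith [ih.2], ?_⟩
    rw [contDen]
    nlinarith [ih.1, ih.2, hc n]

/-- Expansion of the continuants at the first partial quotient instead of the last one. -/
theorem cont_succ_left (c : ℕ → ℤ) (n : ℕ) :
    contNum c (n + 1) = c 0 * contNum (fun k => c (k + 1)) n + contDen (fun k => c (k + 1)) n ∧
      contDen c (n + 1) = contNum (fun k => c (k + 1)) n := by
  induction n using Nat.twoStepInduction with
  | zero => simp [contNum, contDen]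
  | one => simp [contNum, contDen]; ring
  | more n ih1 ih2 =>
    constructor
    · rw [contNum, ih1.1, ih2.1]
      simp only [contNum, contDen]; ring
    · rw [contDen, ih1.2, ih2.2]
      simp only [contNum]

/-! ### Complete quotients and convergents of an irrational number -/

theorem completeQuotient_succ_left (x : ℝ) (n : ℕ) :
    completeQuotient x (n + 1) = completeQuotient (Int.fract x)⁻¹ n := by
  induction n with
  | zero => rw [completeQuotient, completeQuotient, completeQuotient, one_div, Int.fract]
  | succ n ih => rw [completeQuotient, ih, ← completeQuotient]

theorem completeQuotient_add (x : ℝ) (m n : ℕ) :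
    completeQuotient x (m + n) = completeQuotient (completeQuotient x m) n := by
  induction n with
  | zero => rfl
  | succ n ih => rw [← add_assoc, completeQuotient, ih, ← completeQuotient]

theorem irrational_completeQuotient {x : ℝ} (hx : Irrational x) (n : ℕ) :
    Irrational (completeQuotient x n) := by
  induction n with
  | zero => exact hx
  | succ n ih => rw [completeQuotient, one_div, irrational_inv_iff]; exact ih.sub_intCast _

theorem one_le_partialQuotient_succ {x : ℝ} (hx : Irrational x) (n : ℕ) :
    1 ≤ partialQuotient x (n + 1) := by
  rw [partialQuotient, completeQuotient, Int.le_floor, Int.cast_one]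
  have h0 : completeQuotient x n - ⌊completeQuotient x n⌋ ≠ 0 :=
    ((irrational_completeQuotient hx n).sub_intCast _).ne_zero
  have h1 : 0 < completeQuotient x n - ⌊completeQuotient x n⌋ :=
    lt_of_le_of_ne (Int.fract_nonneg _) h0.symm
  rw [le_div_iff₀ h1, one_mul]
  exact (Int.fract_lt_one _).le

theorem convergent_eq_contNum_div_contDen (n : ℕ) {x : ℝ} (hx : Irrational x) :
    x.convergent n =
      (contNum (partialQuotient x) (n + 1) : ℚ) / contDen (partialQuotient x) (n + 1) := by
  induction n generalizing x with
  | zero => simp [contNum, contDen, partialQuotient, completeQuotient]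
  | succ n ih =>
    have hy : Irrational (Int.fract x)⁻¹ := irrational_inv_iff.mpr (hx.sub_intCast _)
    have hpq : (fun k => partialQuotient x (k + 1)) = partialQuotient (Int.fract x)⁻¹ := by
      funext k
      rw [partialQuotient, completeQuotient_succ_left, ← partialQuotient]
    have hl := cont_succ_left (partialQuotient x) (n + 1)
    have hpos := (contDen_pos (one_le_partialQuotient_succ hx) (n + 1)).2
    rw [hpq] at hl
    rw [hl.2] at hpos
    have hne : (contNum (partialQuotient (Int.fract x)⁻¹) (n + 1) : ℚ) ≠ 0 := by
      exact_mod_cast (by omega : contNum (partialQuotient (Int.fract x)⁻¹) (n + 1) ≠ 0)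
    have h0 : partialQuotient x 0 = ⌊x⌋ := rfl
    rw [Real.convergent_succ, ih hy, hl.1, hl.2, h0]
    push_cast
    generalize (contNum (partialQuotient (Int.fract x)⁻¹) (n + 1) : ℚ) = p at hne ⊢
    field_simp

theorem eq_of_partialQuotient_eq {x y : ℝ} (hx : Irrational x) (hy : Irrational y)
    (h : ∀ n, partialQuotient x n = partialQuotient y n) : x = y := by
  have hxc := GenContFract.of_convergence x
  have hyc := GenContFract.of_convergence y
  have : (GenContFract.of x).convs = (GenContFract.of y).convs := by
    funext n
    rw [Real.convs_eq_convergent, Real.convs_eq_convergent,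
      convergent_eq_contNum_div_contDen n hx, convergent_eq_contNum_div_contDen n hy, funext h]
  rw [this] at hxc
  exact tendsto_nhds_unique hxc hyc

/-! ### The sequences attached to a square root -/

theorem partialQuotient_sqrt_succ (d n : ℕ) :
    partialQuotient √(d : ℝ) (n + 1) = partialQuotient (⌊√(d : ℝ)⌋ + √(d : ℝ)) (n + 1) := by
  rw [partialQuotient, partialQuotient, completeQuotient_succ_left, completeQuotient_succ_left,
    Int.fract_intCast_add]

theorem uSeq_zero (d : ℕ) : uSeq d 0 = ⌊√(d : ℝ)⌋ := rfl

theorem vSeq_zero (d : ℕ) : vSeq d 0 = 1 := rfl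

theorem uSeq_succ (d n : ℕ) : uSeq d (n + 1) =
    partialQuotient (⌊√(d : ℝ)⌋ + √(d : ℝ)) n * vSeq d n - uSeq d n := rfl

theorem uSeq_one (d : ℕ) : uSeq d 1 = ⌊√(d : ℝ)⌋ := by
  simp [uSeq_succ, uSeq_zero, vSeq_zero, partialQuotient, completeQuotient]

theorem vSeq_dvd_add (d n : ℕ) : vSeq d n ∣ uSeq d n + uSeq d (n + 1) :=
  ⟨partialQuotient (⌊√(d : ℝ)⌋ + √(d : ℝ)) n, by rw [uSeq_succ]; ring⟩

theorem vSeq_mul_succ {d : ℕ} (hd : ¬ IsSquare d) (n : ℕ) :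
    vSeq d n * vSeq d (n + 1) = d - uSeq d (n + 1) ^ 2 := by
  have h1 := (uvSeq_spec hd n).2.2.2.1
  have h2 : vSeq d n ∣ (d : ℤ) - uSeq d (n + 1) ^ 2 := by
    have e : (d : ℤ) - uSeq d (n + 1) ^ 2 = (d - uSeq d n ^ 2) +
      (uSeq d n + uSeq d (n + 1)) * (uSeq d n - uSeq d (n + 1)) := by ring
    rw [e]
    exact dvd_add h1 ((vSeq_dvd_add d n).mul_right _)
  exact Int.mul_ediv_cancel' h2

theorem floor_lt_uSeq_succ_add_vSeq {d : ℕ} (hd : ¬ IsSquare d) (n : ℕ) :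
    ⌊√(d : ℝ)⌋ < uSeq d (n + 1) + vSeq d n := by
  obtain ⟨-, hv, -, -, hx, -⟩ := uvSeq_spec hd n
  have hvR : (0 : ℝ) < vSeq d n := by exact_mod_cast hv
  have h := Int.lt_floor_add_one (completeQuotient (⌊√(d : ℝ)⌋ + √(d : ℝ)) n)
  rw [← partialQuotient] at h
  nth_rewrite 1 [hx] at h
  rw [div_lt_iff₀ hvR] at h
  rw [Int.floor_lt, uSeq_succ]
  push_cast
  linarith

/-- The inequality `√d - v_n < u_n`, which says that the complete quotient is reduced. -/
theorem floor_lt_uSeq_add_vSeq {d : ℕ} (hd : ¬ IsSquare d) (n : ℕ) :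
    ⌊√(d : ℝ)⌋ < uSeq d n + vSeq d n := by
  cases n with
  | zero => rw [uSeq_zero, vSeq_zero]; omega
  | succ n =>
    obtain ⟨-, hv, hu, -, -, hx⟩ := uvSeq_spec hd n
    obtain ⟨-, hv', hu', -, -, -⟩ := uvSeq_spec hd (n + 1)
    have hmul := vSeq_mul_succ hd n
    have hc : 1 ≤ partialQuotient (⌊√(d : ℝ)⌋ + √(d : ℝ)) n :=
      Int.le_floor.mpr (by simpa using hx.le)
    have hus := uSeq_succ d n
    have hs : ⌊√(d : ℝ)⌋ ^ 2 ≤ (d : ℤ) := by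
      have h0 : (0 : ℝ) ≤ (⌊√(d : ℝ)⌋ : ℝ) := by
        exact_mod_cast Int.floor_nonneg.mpr (Real.sqrt_nonneg _)
      have h1 := pow_le_pow_left₀ h0 (Int.floor_le √(d : ℝ)) 2
      rw [Real.sq_sqrt (Nat.cast_nonneg d)] at h1
      exact_mod_cast h1
    have hne : ⌊√(d : ℝ)⌋ ^ 2 ≠ (d : ℤ) := by
      intro h
      refine hd ⟨⌊√(d : ℝ)⌋.natAbs, ?_⟩
      zify
      rw [abs_mul_abs_self, ← h, sq]
    have hlt := lt_of_le_of_ne hs hne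
    -- otherwise `v v' ≤ (s + u') (s - u') = s² - u'² < d - u'²`, where `s = ⌊√d⌋`
    by_contra! hcon
    have hvle : vSeq d n ≤ uSeq d (n + 1) + ⌊√(d : ℝ)⌋ := by nlinarith
    nlinarith

/-- An integer is determined by its residue class modulo `v` and by lying in `(s - v, s]`. -/
theorem eq_of_dvd_add_of_mem_window {v s w x y : ℤ} (hx : v ∣ x + w) (hy : v ∣ y + w)
    (hxs : x ≤ s) (hys : y ≤ s) (hxv : s < x + v) (hyv : s < y + v) : x = y := by
  have h : v ∣ x - y := by simpa using dvd_sub hx hy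
  have := Int.eq_zero_of_abs_lt_dvd h (abs_lt.mpr ⟨by linarith, by linarith⟩)
  linarith

theorem uvSeq_succ_congr {d : ℕ} (hd : ¬ IsSquare d) {i j : ℕ}
    (hu : uSeq d i = uSeq d j) (hv : vSeq d i = vSeq d j) :
    uSeq d (i + 1) = uSeq d (j + 1) ∧ vSeq d (i + 1) = vSeq d (j + 1) := by
  have hu' : uSeq d (i + 1) = uSeq d (j + 1) := by
    refine eq_of_dvd_add_of_mem_window (v := vSeq d i) (s := ⌊√(d : ℝ)⌋) (w := uSeq d i)
      ?_ ?_ (uvSeq_spec hd _).2.2.1 (uvSeq_spec hd _).2.2.1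
      (floor_lt_uSeq_succ_add_vSeq hd i) ?_
    · rw [add_comm]; exact vSeq_dvd_add d i
    · rw [hu, hv, add_comm]; exact vSeq_dvd_add d j
    · rw [hv]; exact floor_lt_uSeq_succ_add_vSeq hd j
  refine ⟨hu', mul_left_cancel₀ (uvSeq_spec hd i).2.1.ne' ?_⟩
  rw [vSeq_mul_succ hd i, hv, vSeq_mul_succ hd j, hu']

/-- The recursion can be run backwards. -/
theorem uvSeq_congr_of_succ {d : ℕ} (hd : ¬ IsSquare d) {i j : ℕ}
    (hu : uSeq d (i + 1) = uSeq d (j + 1)) (hv : vSeq d (i + 1) = vSeq d (j + 1)) :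
    uSeq d i = uSeq d j ∧ vSeq d i = vSeq d j := by
  have hv' : vSeq d i = vSeq d j := by
    refine mul_right_cancel₀ (uvSeq_spec hd (i + 1)).2.1.ne' ?_
    rw [vSeq_mul_succ hd i, hv, vSeq_mul_succ hd j, hu]
  refine ⟨?_, hv'⟩
  refine eq_of_dvd_add_of_mem_window (v := vSeq d i) (s := ⌊√(d : ℝ)⌋) (w := uSeq d (i + 1))
    (vSeq_dvd_add d i) ?_ (uvSeq_spec hd _).2.2.1 (uvSeq_spec hd _).2.2.1
    (floor_lt_uSeq_add_vSeq hd i) ?_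
  · rw [hu, hv']; exact vSeq_dvd_add d j
  · rw [hv']; exact floor_lt_uSeq_add_vSeq hd j

/-- Reflection principle: the recursion read backwards is the recursion itself, with `u` shifted
by one against `v`. Hence one coincidence `(u_{i+1}, v_i) = (u_j, v_j)` propagates. -/
theorem uvSeq_reflect {d : ℕ} (hd : ¬ IsSquare d) {i : ℕ} :
    ∀ {k l : ℕ}, uSeq d (i + 1) = uSeq d (l + k) → vSeq d i = vSeq d (l + k) →
      uSeq d (i + k + 1) = uSeq d l ∧ vSeq d (i + k) = vSeq d l := by
  intro k
  induction k with
  | zero => intro l hu hv; exact ⟨hu, hv⟩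
  | succ k ih =>
    intro l hu hv
    have e : l + (k + 1) = (l + 1) + k := by ring
    rw [e] at hu hv
    obtain ⟨hu', hv'⟩ := ih hu hv
    rw [← add_assoc]
    have hvs : vSeq d (i + k + 1) = vSeq d l := by
      refine mul_left_cancel₀ (uvSeq_spec hd (i + k)).2.1.ne' ?_
      rw [vSeq_mul_succ hd, hu', hv', mul_comm, vSeq_mul_succ hd l]
    refine ⟨?_, hvs⟩
    refine eq_of_dvd_add_of_mem_window (v := vSeq d l) (s := ⌊√(d : ℝ)⌋) (w := uSeq d (l + 1))
      ?_ (vSeq_dvd_add d l) (uvSeq_spec hd _).2.2.1 (uvSeq_spec hd _).2.2.1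
      ?_ (floor_lt_uSeq_add_vSeq hd l)
    · rw [← hvs, ← hu', add_comm (uSeq d _)]; exact vSeq_dvd_add d (i + k + 1)
    · rw [← hvs]; exact floor_lt_uSeq_succ_add_vSeq hd (i + k + 1)

/-- `v_n = 1` forces the sequence to start afresh at `n`. -/
theorem uSeq_eq_floor_of_vSeq_eq_one {d : ℕ} (hd : ¬ IsSquare d) {n : ℕ} (h : vSeq d n = 1) :
    uSeq d n = ⌊√(d : ℝ)⌋ := by
  have h1 := floor_lt_uSeq_add_vSeq hd n
  have h2 := (uvSeq_spec hd n).2.2.1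
  omega

/-! ### Periods -/

theorem uvSeq_add_of_vSeq_eq_one {d : ℕ} (hd : ¬ IsSquare d) {k : ℕ} (h : vSeq d k = 1) (n : ℕ) :
    uSeq d (n + k) = uSeq d n ∧ vSeq d (n + k) = vSeq d n := by
  induction n with
  | zero => rw [zero_add, h, uSeq_eq_floor_of_vSeq_eq_one hd h]; exact ⟨rfl, rfl⟩
  | succ n ih => rw [add_right_comm]; exact uvSeq_succ_congr hd ih.1 ih.2

theorem isCFPeriod_sqrt_of_vSeq_eq_one {d : ℕ} (hd : ¬ IsSquare d) {k : ℕ} (hk : 0 < k)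
    (h : vSeq d k = 1) : IsCFPeriod √(d : ℝ) k := by
  refine ⟨hk, 1, fun n hn => ?_⟩
  obtain ⟨m, rfl⟩ : ∃ m, n = m + 1 := ⟨n - 1, by omega⟩
  rw [add_right_comm, partialQuotient_sqrt_succ, partialQuotient_sqrt_succ, partialQuotient,
    partialQuotient, (uvSeq_spec hd _).2.2.2.2.1, (uvSeq_spec hd _).2.2.2.2.1, add_right_comm,
    (uvSeq_add_of_vSeq_eq_one hd h (m + 1)).1, (uvSeq_add_of_vSeq_eq_one hd h (m + 1)).2]

/-- `u` and `v` are determined by the complete quotient `(u + √d) / v`. -/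
theorem uvSeq_eq_of_completeQuotient_eq {d : ℕ} (hd : ¬ IsSquare d) {i j : ℕ}
    (h : completeQuotient (⌊√(d : ℝ)⌋ + √(d : ℝ)) i = completeQuotient (⌊√(d : ℝ)⌋ + √(d : ℝ)) j) :
    uSeq d i = uSeq d j ∧ vSeq d i = vSeq d j := by
  have hirr : Irrational √(d : ℝ) := irrational_sqrt_natCast_iff.mpr hd
  obtain ⟨-, hvi, -, -, hi, -⟩ := uvSeq_spec hd i
  obtain ⟨-, hvj, -, -, hj, -⟩ := uvSeq_spec hd j
  have hvi' : (vSeq d i : ℝ) ≠ 0 := by exact_mod_cast hvi.ne'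
  have hvj' : (vSeq d j : ℝ) ≠ 0 := by exact_mod_cast hvj.ne'
  rw [hi, hj, div_eq_div_iff hvi' hvj'] at h
  have hv : vSeq d i = vSeq d j := by
    by_contra hne
    have h1 := hirr.mul_intCast (sub_ne_zero.mpr hne)
    refine h1.ne_int (uSeq d i * vSeq d j - uSeq d j * vSeq d i) ?_
    push_cast
    linarith
  refine ⟨?_, hv⟩
  rw [hv] at h
  have h2 := mul_right_cancel₀ hvj' h
  exact_mod_cast add_right_cancel h2

theorem vSeq_eq_one_of_isCFPeriod_sqrt {d : ℕ} (hd : ¬ IsSquare d) {T : ℕ}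
    (h : IsCFPeriod √(d : ℝ) T) : vSeq d T = 1 := by
  obtain ⟨-, n₀, hn₀⟩ := h
  set y : ℝ := ⌊√(d : ℝ)⌋ + √(d : ℝ) with hy
  have hirr : Irrational y := (irrational_sqrt_natCast_iff.mpr hd).intCast_add _
  have hcq : completeQuotient y (n₀ + 1 + T) = completeQuotient y (n₀ + 1) := by
    refine eq_of_partialQuotient_eq (irrational_completeQuotient hirr _)
      (irrational_completeQuotient hirr _) fun n => ?_
    have h1 := hn₀ (n₀ + n + 1) (by omega)
    rw [add_right_comm, partialQuotient_sqrt_succ, partialQuotient_sqrt_succ, ← hy] at h1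
    rw [partialQuotient, partialQuotient, ← completeQuotient_add, ← completeQuotient_add,
      ← partialQuotient, ← partialQuotient]
    convert h1 using 2 <;> ring
  have huv := uvSeq_eq_of_completeQuotient_eq hd hcq
  -- the coincidence of ranks `n₀ + 1 + T` and `n₀ + 1` is carried down to the ranks `T` and `0`
  have hback : ∀ k, uSeq d (k + T) = uSeq d k ∧ vSeq d (k + T) = vSeq d k →
      vSeq d T = 1 := by
    intro k
    induction k with
    | zero => intro hk; rw [zero_add] at hk; exact hk.2
    | succ k ih =>
      intro hk
      rw [add_right_comm] at hk
      exact ih (uvSeq_congr_of_succ hd hk.1 hk.2)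
  exact hback _ huv

theorem vSeq_add_mul_of_vSeq_eq_one {d : ℕ} (hd : ¬ IsSquare d) {T : ℕ} (h : vSeq d T = 1)
    (n k : ℕ) : vSeq d (n + T * k) = vSeq d n := by
  induction k with
  | zero => rfl
  | succ k ih => rw [mul_add, mul_one, ← add_assoc, (uvSeq_add_of_vSeq_eq_one hd h _).2, ih]

theorem vSeq_minCFPeriod {d : ℕ} (hd : ¬ IsSquare d) : vSeq d (minCFPeriod √(d : ℝ)) = 1 :=
  vSeq_eq_one_of_isCFPeriod_sqrt hd (isLeast_minCFPeriod hd).1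

theorem minCFPeriod_sqrt_dvd {d : ℕ} (hd : ¬ IsSquare d) {k : ℕ} (h : vSeq d k = 1) :
    minCFPeriod √(d : ℝ) ∣ k := by
  set T := minCFPeriod √(d : ℝ) with hT
  have hTpos : 0 < T := (isLeast_minCFPeriod hd).1.1
  have hmod : vSeq d (k % T) = 1 := by
    rw [← vSeq_add_mul_of_vSeq_eq_one hd (vSeq_minCFPeriod hd) (k % T) (k / T), ← hT,
      Nat.mod_add_div, h]
  by_contra hnd
  have h0 : 0 < k % T := Nat.pos_of_ne_zero fun h0 => hnd (Nat.dvd_of_mod_eq_zero h0)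
  exact absurd ((isLeast_minCFPeriod hd).2 (isCFPeriod_sqrt_of_vSeq_eq_one hd h0 hmod))
    (not_le.mpr (Nat.mod_lt k hTpos))

/-- The palindromic symmetry of the period, at its centre. -/
theorem vSeq_dvd_two_mul_uSeq {d : ℕ} (hd : ¬ IsSquare d) {N : ℕ} (h : vSeq d (N + N) = 1) :
    vSeq d N ∣ 2 * uSeq d N := by
  have hr := uvSeq_reflect hd (i := 0) (k := N) (l := N)
    (by rw [uSeq_eq_floor_of_vSeq_eq_one hd h]; exact uSeq_one d) (by rw [h]; rfl)
  have h1 := vSeq_dvd_add d N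
  rw [zero_add] at hr
  rwa [show uSeq d (N + 1) = uSeq d N from hr.1, ← two_mul] at h1

/-- Conversely to `vSeq_dvd_two_mul_uSeq`, `v_m ∣ 2 u_m` makes `m` a centre of symmetry; combined
with the symmetry about `0` this makes `2 m` a period. -/
theorem vSeq_add_self_eq_one {d : ℕ} (hd : ¬ IsSquare d) {m : ℕ} (h : vSeq d m ∣ 2 * uSeq d m) :
    vSeq d (m + m) = 1 := by
  have hu : uSeq d (m + 1) = uSeq d m := by
    refine eq_of_dvd_add_of_mem_window (v := vSeq d m) (s := ⌊√(d : ℝ)⌋) (w := uSeq d m)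
      ?_ ?_ (uvSeq_spec hd _).2.2.1 (uvSeq_spec hd _).2.2.1
      (floor_lt_uSeq_succ_add_vSeq hd m) (floor_lt_uSeq_add_vSeq hd m)
    · rw [add_comm]; exact vSeq_dvd_add d m
    · rwa [← two_mul]
  exact (uvSeq_reflect hd (i := m) (k := m) (l := 0) (by rwa [zero_add]) (by rw [zero_add])).2

/-! ### Convergents and the norm form -/

theorem cont_sqrt_spec {d : ℕ} (hd : ¬ IsSquare d) (n : ℕ) :
    contNum (partialQuotient √(d : ℝ)) (n + 1) =
        uSeq d (n + 1) * contDen (partialQuotient √(d : ℝ)) (n + 1) +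
          vSeq d (n + 1) * contDen (partialQuotient √(d : ℝ)) n ∧
      d * contDen (partialQuotient √(d : ℝ)) (n + 1) =
        uSeq d (n + 1) * contNum (partialQuotient √(d : ℝ)) (n + 1) +
          vSeq d (n + 1) * contNum (partialQuotient √(d : ℝ)) n := by
  induction n with
  | zero =>
    have h := vSeq_mul_succ hd 0
    rw [zero_add, vSeq_zero, one_mul, uSeq_one] at h
    have h0 : partialQuotient √(d : ℝ) 0 = ⌊√(d : ℝ)⌋ := rfl
    simp only [zero_add, contNum, contDen, uSeq_one, h, h0]
    constructor <;> ring
  | succ n ih =>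
    obtain ⟨h1, h2⟩ := ih
    have hv := (uvSeq_spec hd (n + 1)).2.1.ne'
    have hmul := vSeq_mul_succ hd (n + 1)
    have hu := uSeq_succ d (n + 1)
    rw [← partialQuotient_sqrt_succ] at hu
    simp only [contNum, contDen]
    set c := partialQuotient √(d : ℝ)
    set u := uSeq d (n + 1)
    set v := vSeq d (n + 1)
    set u' := uSeq d (n + 1 + 1)
    set v' := vSeq d (n + 1 + 1)
    constructor <;> refine mul_left_cancel₀ hv ?_
    · linear_combination u' * h1 - h2 - contDen c (n + 1) * hmul
        - (contNum c (n + 1) - u' * contDen c (n + 1)) * hu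
    · linear_combination u' * h2 - d * h1 - contNum c (n + 1) * hmul
        - (d * contDen c (n + 1) - u' * contNum c (n + 1)) * hu

/-- The norm of a convergent of `√d`. -/
theorem contNum_sq_sub {d : ℕ} (hd : ¬ IsSquare d) (n : ℕ) :
    contNum (partialQuotient √(d : ℝ)) (n + 1) ^ 2 -
        d * contDen (partialQuotient √(d : ℝ)) (n + 1) ^ 2 = (-1) ^ (n + 1) * vSeq d (n + 1) := by
  obtain ⟨h1, h2⟩ := cont_sqrt_spec hd n
  rw [← contNum_det (partialQuotient √(d : ℝ)) n]
  linear_combination contNum (partialQuotient √(d : ℝ)) (n + 1) * h1 -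
    contDen (partialQuotient √(d : ℝ)) (n + 1) * h2

/-- Coprime solutions of `X² - d Y² = a` with `0 < a < √d` come from convergents of `√d`, by
Legendre's criterion. -/
theorem exists_eq_cont_of_sq_sub {d : ℕ} (hd : ¬ IsSquare d) {a X Y : ℤ} (ha : 0 < a)
    (had : a ^ 2 < d) (hX : 0 < X) (hY : 0 < Y) (hXY : IsCoprime X Y)
    (h : X ^ 2 - d * Y ^ 2 = a) :
    ∃ n, X = contNum (partialQuotient √(d : ℝ)) (n + 1) ∧
      Y = contDen (partialQuotient √(d : ℝ)) (n + 1) := by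
  have hirr : Irrational √(d : ℝ) := irrational_sqrt_natCast_iff.mpr hd
  have hsq : √(d : ℝ) ^ 2 = d := Real.sq_sqrt (Nat.cast_nonneg d)
  have haR : (0 : ℝ) < a := by exact_mod_cast ha
  have hXR : (0 : ℝ) < X := by exact_mod_cast hX
  have hYR : (0 : ℝ) < Y := by exact_mod_cast hY
  have has : (a : ℝ) < √(d : ℝ) := Real.lt_sqrt_of_sq_lt (by exact_mod_cast had)
  have hR : (X - √(d : ℝ) * Y) * (X + √(d : ℝ) * Y) = a := by
    have : (X : ℝ) ^ 2 - d * (Y : ℝ) ^ 2 = a := by exact_mod_cast h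
    linear_combination this - (Y : ℝ) ^ 2 * hsq
  have hcop : X.natAbs.Coprime Y.natAbs := Int.isCoprime_iff_gcd_eq_one.mp hXY
  have hnum : ((X : ℚ) / Y).num = X := Rat.num_div_eq_of_coprime hY hcop
  have hden : (((X : ℚ) / Y).den : ℤ) = Y := Rat.den_div_eq_of_coprime hY hcop
  have hsYpos : 0 < √(d : ℝ) * Y := mul_pos (haR.trans has) hYR
  have hpos : 0 < X - √(d : ℝ) * Y :=
    pos_of_mul_pos_left (by rw [hR]; exact haR) (by linarith)
  have hdenR : ((((X : ℚ) / Y).den : ℕ) : ℝ) = Y := by exact_mod_cast hden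
  -- `X / Y - √d = a / (Y (X + √d Y))`, which is below `1 / (2 Y²)` as `X > √d Y` and `a < √d`
  have hleg : |√(d : ℝ) - (((X : ℚ) / Y : ℚ) : ℝ)| <
      1 / (2 * ((((X : ℚ) / Y).den : ℕ) : ℝ) ^ 2) := by
    rw [hdenR, abs_sub_comm]
    push_cast
    have e : (X : ℝ) / Y - √(d : ℝ) = (X - √(d : ℝ) * Y) / Y := by field_simp
    rw [e, abs_of_pos (div_pos hpos hYR), div_lt_div_iff₀ hYR (by positivity)]
    have h1 : (X - √(d : ℝ) * Y) * (2 * Y) < 1 := by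
      have h2 : (X - √(d : ℝ) * Y) * (2 * Y) * √(d : ℝ) < 1 * √(d : ℝ) := by nlinarith
      exact lt_of_mul_lt_mul_right h2 (haR.trans has).le
    nlinarith
  obtain ⟨n, hn⟩ := Real.exists_rat_eq_convergent hleg
  refine ⟨n, ?_⟩
  rw [convergent_eq_contNum_div_contDen n hirr] at hn
  set c := partialQuotient √(d : ℝ) with hc
  have hdpos : 0 < contDen c (n + 1) :=
    (contDen_pos (one_le_partialQuotient_succ hirr) n).2
  have hcop' : (contNum c (n + 1)).natAbs.Coprime (contDen c (n + 1)).natAbs := by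
    refine Int.isCoprime_iff_gcd_eq_one.mp ?_
    have hdet := contNum_det c n
    refine ⟨(-1) ^ (n + 1) * contDen c n, -(-1) ^ (n + 1) * contNum c n, ?_⟩
    have hs : ((-1 : ℤ) ^ (n + 1)) * (-1) ^ (n + 1) = 1 := by rw [← mul_pow]; simp
    linear_combination (-1) ^ (n + 1) * hdet + hs
  rw [hn] at hnum hden
  constructor
  · rw [← hnum, Rat.num_div_eq_of_coprime hdpos hcop']
  · rw [← hden, Rat.den_div_eq_of_coprime hdpos hcop']

/-! ### The equation `a x² - b y² = 1` -/

/-- If `v_N = a` divides `u_N`, then `a` divides the numerator of the convergent of index `N - 1`,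
and the norm of that convergent is `a` times `a x² - b y²`. -/
theorem exists_sol_of_vSeq_eq {a b N : ℕ} (hsq : ¬ IsSquare (a * b)) (hN : Even N) (hN0 : 0 < N)
    (hv : vSeq (a * b) N = a) (hu : (a : ℤ) ∣ uSeq (a * b) N) :
    ∃ x y : ℕ, (a : ℤ) * (x : ℤ) ^ 2 - (b : ℤ) * (y : ℤ) ^ 2 = 1 := by
  obtain ⟨n, rfl⟩ : ∃ n, N = n + 1 := ⟨N - 1, by omega⟩
  have hnorm := contNum_sq_sub hsq n
  have hlin := (cont_sqrt_spec hsq n).1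
  rw [hN.neg_one_pow, one_mul, hv] at hnorm
  rw [hv] at hlin
  set p := contNum (partialQuotient √((a * b : ℕ) : ℝ)) (n + 1)
  set q := contDen (partialQuotient √((a * b : ℕ) : ℝ)) (n + 1)
  obtain ⟨x, hx⟩ : (a : ℤ) ∣ p := by
    rw [hlin]; exact dvd_add (hu.mul_right _) (dvd_mul_right _ _)
  have ha : (a : ℤ) ≠ 0 := by rw [← hv]; exact (uvSeq_spec hsq _).2.1.ne'
  refine ⟨x.natAbs, q.natAbs, ?_⟩
  rw [Int.natAbs_sq, Int.natAbs_sq]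
  refine mul_left_cancel₀ ha ?_
  rw [hx] at hnorm
  push_cast at hnorm
  linear_combination hnorm

/-- A solution `(x, y)` yields the convergent `a x / y` of `√(a b)`, hence an index `m` with
`v_m = a`; and `a` divides `u_m` since it divides `a x = u_m y + v_m q_{m-2}`, and is prime
to `y`. -/
theorem exists_vSeq_eq_of_sol {a b x y : ℕ} (ha : 2 ≤ a) (hab : a < b) (hsq : ¬ IsSquare (a * b))
    (h : (a : ℤ) * (x : ℤ) ^ 2 - (b : ℤ) * (y : ℤ) ^ 2 = 1) :
    ∃ m, vSeq (a * b) m = a ∧ (a : ℤ) ∣ uSeq (a * b) m := by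
  have haZ : (2 : ℤ) ≤ a := by exact_mod_cast ha
  have hbZ : (a : ℤ) < b := by exact_mod_cast hab
  have hcopa : IsCoprime (a : ℤ) (y : ℤ) := ⟨x ^ 2, -(b * y), by linear_combination h⟩
  have hcopx : IsCoprime (x : ℤ) (y : ℤ) := ⟨a * x, -(b * y), by linear_combination h⟩
  have hy : (0 : ℤ) < y := by
    rcases Nat.eq_zero_or_pos y with rfl | hy
    · have : (a : ℤ) ∣ 1 := ⟨x ^ 2, by push_cast at h; linear_combination -h⟩
      have := Int.le_of_dvd one_pos this
      omega
    · exact_mod_cast hy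
  have hx : (0 : ℤ) < x := by
    rcases Nat.eq_zero_or_pos x with rfl | hx
    · push_cast at h; nlinarith [sq_nonneg (y : ℤ)]
    · exact_mod_cast hx
  have hXY : ((a * x : ℤ)) ^ 2 - ((a * b : ℕ) : ℤ) * (y : ℤ) ^ 2 = a := by
    push_cast; linear_combination (a : ℤ) * h
  obtain ⟨n, hnum, hden⟩ := exists_eq_cont_of_sq_sub hsq (by omega)
    (by push_cast; nlinarith) (by positivity) hy (hcopa.mul_left hcopx) hXY
  have hnorm := contNum_sq_sub hsq n
  have hlin := (cont_sqrt_spec hsq n).1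
  rw [← hnum, ← hden, hXY] at hnorm
  rw [← hnum, ← hden] at hlin
  have hvpos := (uvSeq_spec hsq (n + 1)).2.1
  have hv : vSeq (a * b) (n + 1) = a := by
    rcases neg_one_pow_eq_or ℤ (n + 1) with h1 | h1 <;> rw [h1] at hnorm <;> linarith
  refine ⟨n + 1, hv, hcopa.dvd_of_dvd_mul_right ?_⟩
  rw [hv] at hlin
  exact (dvd_add_left (dvd_mul_right _ _)).mp (hlin ▸ dvd_mul_right _ _)

theorem mainTheorem4 (a b d T N : ℕ) (ha : 2 ≤ a) (hab : a < b) (hcop : Nat.Coprime a b)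
    (hd : d = a * b) (hsq : ¬ IsSquare d) (hT : T = minCFPeriod √(d : ℝ))
    (hT4 : T ≡ 0 [MOD 4]) (hodd : Odd a) (hN : N = T / 2) :
    ((∃ x y : ℕ, (a : ℤ) * (x : ℤ) ^ 2 - (b : ℤ) * (y : ℤ) ^ 2 = 1) ↔ vSeq d N = (a : ℤ)) ∧
      vSeq d N ∣ 2 * uSeq d N ∧
      (vSeq d N = (a : ℤ) → vSeq d N ∣ uSeq d N) := by
  have hTpos : 0 < T := hT ▸ (isLeast_minCFPeriod hsq).1.1
  have hvT : vSeq d T = 1 := hT ▸ vSeq_minCFPeriod hsq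
  have hT4' : T % 4 = 0 := hT4
  have hTN : T = N + N := by omega
  have hNeven : Even N := Nat.even_iff.mpr (by omega)
  have hdvd : vSeq d N ∣ 2 * uSeq d N := vSeq_dvd_two_mul_uSeq hsq (hTN ▸ hvT)
  have hdvd' : vSeq d N = (a : ℤ) → vSeq d N ∣ uSeq d N := by
    intro hv
    have h2 : IsCoprime (a : ℤ) 2 := by
      exact_mod_cast Nat.isCoprime_iff_coprime.mpr (Nat.coprime_two_right.mpr hodd)
    rw [hv] at hdvd ⊢
    exact h2.dvd_of_dvd_mul_left hdvd
  refine ⟨⟨?_, fun hv => ?_⟩, hdvd, hdvd'⟩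
  · rintro ⟨x, y, h⟩
    subst hd
    obtain ⟨m, hvm, hum⟩ := exists_vSeq_eq_of_sol ha hab hsq h
    have hTm : T ∣ m + m := hT ▸ minCFPeriod_sqrt_dvd hsq
      (vSeq_add_self_eq_one hsq (by rw [hvm]; exact hum.mul_left 2))
    obtain ⟨k, hk⟩ := hTm
    have hm : m = N * k := by rw [hTN] at hk; nlinarith
    rcases Nat.even_or_odd' k with ⟨j, rfl | rfl⟩
    · -- here `m` is a multiple of `T`, so that `v_m = 1`
      have h1 := vSeq_add_mul_of_vSeq_eq_one hsq hvT 0 j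
      rw [show 0 + T * j = m by rw [hm, hTN]; ring, hvm, vSeq_zero] at h1
      omega
    · have h1 := vSeq_add_mul_of_vSeq_eq_one hsq hvT N j
      rw [show N + T * j = m by rw [hm, hTN]; ring, hvm] at h1
      exact h1.symm
  · have hu := hdvd' hv
    subst hd
    exact exists_sol_of_vSeq_eq hsq hNeven (by omega) hv (hv ▸ hu)
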